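/- Let $D$ be an integral domain with quotient field $K$. An overring of $D$ is a ring $T$ with $D\subseteq T\subseteq K$; the Zariski topology on the set of overrings has the sets $\{T\mid x_1,\dots,x_n\in T\}$ ($x_1,\dots,x_n\in K$) as a subbasis. For an overring $T$ of $D$ put $\sigma(T)=\{Q\cap D\mid Q\in\mathrm{Spec}(T)\}$. A family $\Theta$ of overrings of $D$ is *complete* if $I=\bigcap\{IT\mid T\in\Theta\}$ for every ideal $I$ of $D$ (the empty intersection being $K$), *independent* if $\sigma(A)\cap\sigma(B)=\{(0)\}$ for all $A\neq B$ in $\Theta$, and *locally finite* if every nonzero $x\in K$ is a nonunit in only finitely many members of $\Theta$. Let $\Theta$ be a family of overrings of $D$ with $K\notin\Theta$ or $\Theta=\{K\}$, and suppose that $\Theta$ is complete and independent. Then - $\Theta$ is a *Jaffard family* of $D$ if every $T\in\Theta$ is flat over $D$ and $\Theta$ is locally finite; a *Jaffard overring* of $D$ is a member of some Jaffard family of $D$; - $\Theta$ is a *pre-Jaffard family* of $D$ if every $T\in\Theta$ is flat over $D$ and $\Theta$ is compact in the Zariski topology (every open cover has a finite subcover); - $\Theta$ is a *weak Jaffard family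 of $D$ pointed at $S\in\Theta$* if $S$ is flat over $D$ and every $T\in\Theta\setminus\{S\}$ is a Jaffard overring of $D$. Let $\Theta$ be a pre-Jaffard family of $D$. Define its derived sequence by $T_0:=D$, $\Theta_0:=\Theta$ and, for ordinals $\alpha>0$, $$\Theta_{\alpha}:=\Theta_\gamma\setminus(\Theta_\gamma)_J\ \text{ if }\alpha=\gamma+1,\qquad \Theta_\alpha:=\bigcap_{\beta<\alpha}\Theta_\beta\ \text{ if }\alpha\text{ is a limit ordinal},\qquad T_\alpha:=\bigcap\{S\mid S\in\Theta_\alpha\},$$ where $(\Theta_\gamma)_J$ is the set of those members of $\Theta_\gamma$ that are Jaffard overrings of $T_\gamma$, and $T_\alpha:=K$ if $\Theta_\alpha=\emptyset$. Then, for every ordinal $\alpha$ such that $\Theta_\alpha\neq\emptyset$: (a) $\Theta_\alpha$ is a pre-Jaffard family of $T_\alpha$; (b) if $\alpha=\gamma+1$ is a successor ordinal, then $(\Theta_\gamma)_J\cup\{T_\alpha\}$ is a weak Jaffard family of $T_\gamma$ pointed at $T_\alpha$. -/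

import Mathlib

universe u v

namespace JaffardFamilies

variable {K : Type u} [Field K]

/-! Throughout, the domain `D` is a subring of the field `K`, which in the theorem is its field of
fractions. An overring of `D` is a subring `T` of `K` with `D ≤ T`, and `K` itself, as an overring,
is `⊤ : Subring K`. A family of overrings is a set of subrings, so that the same set can be regarded
as a family of overrings of different base rings. -/

/-- The basic set `B(x₁, …, xₙ)` of the subrings of `K` that contain a given finite set. -/
def basicOpen (F : Finset K) : Set (Subring K) := {T | ∀ x ∈ F, x ∈ T}

/-- The Zariski topology. The Zariski topology on the set of overrings of `D` is the one induced by
this topology on the subset `{T | D ≤ T}`; in particular compactness of a set of overrings of `D`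
does not depend on `D`. -/
abbrev zariskiTopology (K : Type u) [Field K] : TopologicalSpace (Subring K) :=
  TopologicalSpace.generateFrom (Set.range basicOpen)

/-- Compactness (every open cover has a finite subcover) in the Zariski topology. -/
def IsZariskiCompact (Θ : Set (Subring K)) : Prop :=
  @IsCompact (Subring K) (zariskiTopology K) Θ

/-- `T` is an overring of `D` that is flat as a `D`-module. -/
def IsFlatOverring (D T : Subring K) : Prop :=
  ∃ h : D ≤ T, (Subring.inclusion h).Flat

/-- `σ(T)`: the set of the primes `Q ∩ D` of `D`, where `Q` is a prime of the overring `T`. -/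
def contractedPrimes {D T : Subring K} (h : D ≤ T) : Set (PrimeSpectrum D) :=
  Set.range (PrimeSpectrum.comap (Subring.inclusion h))

/-- The extension `I T` inside `K` of an ideal `I` of `D` to an overring `T` of `D`: the
`T`-submodule of `K` generated by `I`. -/
def extension {D : Subring K} (I : Ideal D) (T : Subring K) : Submodule T K :=
  Submodule.span T ((fun x : D => (x : K)) '' (I : Set D))

/-- `Θ` is complete: `I = ⋂ {I T | T ∈ Θ}` for every ideal `I` of `D`. The intersection takes
place in `K`, so that it is `K` for the empty family. -/
def IsCompleteFamily (D : Subring K) (Θ : Set (Subring K)) : Prop :=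
  ∀ I : Ideal D, (fun x : D => (x : K)) '' (I : Set D) = ⋂ T ∈ Θ, (extension I T : Set K)

/-- `Θ` is independent: `σ(A) ∩ σ(B) = {(0)}` for all distinct members `A`, `B`. -/
def IsIndependentFamily (D : Subring K) (Θ : Set (Subring K)) : Prop :=
  ∀ A ∈ Θ, ∀ B ∈ Θ, A ≠ B → ∀ (hA : D ≤ A) (hB : D ≤ B), contractedPrimes hA ∩ contractedPrimes hB = {⊥}

/-- `Θ` is locally finite: every nonzero `x` in `K` is a nonunit in only finitely many members. -/
def IsLocallyFiniteFamily (Θ : Set (Subring K)) : Prop :=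
  ∀ x : K, x ≠ 0 → {T ∈ Θ | ∃ h : x ∈ T, ¬ IsUnit (⟨x, h⟩ : T)}.Finite

/-- Jaffard families of `D`. -/
structure IsJaffardFamily (D : Subring K) (Θ : Set (Subring K)) : Prop where
  overring : ∀ T ∈ Θ, D ≤ T
  top_notMem_or : ⊤ ∉ Θ ∨ Θ = {⊤}
  flat : ∀ T ∈ Θ, IsFlatOverring D T
  complete : IsCompleteFamily D Θ
  independent : IsIndependentFamily D Θ
  locallyFinite : IsLocallyFiniteFamily Θ

/-- A Jaffard overring of `D` is a member of some Jaffard family of `D`. -/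
def IsJaffardOverring (D T : Subring K) : Prop :=
  ∃ Θ : Set (Subring K), IsJaffardFamily D Θ ∧ T ∈ Θ

/-- Pre-Jaffard families of `D`. -/
structure IsPreJaffardFamily (D : Subring K) (Θ : Set (Subring K)) : Prop where
  overring : ∀ T ∈ Θ, D ≤ T
  top_notMem_or : ⊤ ∉ Θ ∨ Θ = {⊤}
  flat : ∀ T ∈ Θ, IsFlatOverring D T
  independent : IsIndependentFamily D Θ
  complete : IsCompleteFamily D Θ
  compact : IsZariskiCompact Θ

/-- Weak Jaffard families of `D` pointed at `S`. -/
structure IsWeakJaffardFamily (D : Subring K) (Θ : Set (Subring K)) (S : Subring K) : Prop where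
  overring : ∀ T ∈ Θ, D ≤ T
  mem : S ∈ Θ
  top_notMem_or : ⊤ ∉ Θ ∨ Θ = {⊤}
  complete : IsCompleteFamily D Θ
  independent : IsIndependentFamily D Θ
  jaffard : ∀ T ∈ Θ \ {S}, IsJaffardOverring D T
  flat : IsFlatOverring D S

/-- `Θ_J`: the set of the members of `Θ` that are Jaffard overrings of `D`. -/
def jaffardPart (D : Subring K) (Θ : Set (Subring K)) : Set (Subring K) :=
  {T ∈ Θ | IsJaffardOverring D T}

/-- The pairs `(T_α, Θ_α)`, by transfinite recursion. Here `sInf` is the intersection of subrings;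
it is `⊤`, that is `K`, for the empty set. -/
noncomputable def derivedPair (D : Subring K) (Θ : Set (Subring K)) (α : Ordinal.{v}) :
    Subring K × Set (Subring K) :=
  Ordinal.limitRecOn α (D, Θ)
    (fun _ p => (sInf (p.2 \ jaffardPart p.1 p.2), p.2 \ jaffardPart p.1 p.2))
    (fun α _ p => (sInf (⋂ (β) (h : β < α), (p β h).2), ⋂ (β) (h : β < α), (p β h).2))

/-- The ring `T_α` of the derived sequence of `Θ`. -/
noncomputable def derivedRing (D : Subring K) (Θ : Set (Subring K)) (α : Ordinal.{v}) :
    Subring K :=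
  (derivedPair D Θ α).1

/-- The subfamily `Θ_α` of `Θ` that belongs to `T_α`. -/
noncomputable def derivedFamily (D : Subring K) (Θ : Set (Subring K)) (α : Ordinal.{v}) :
    Set (Subring K) :=
  (derivedPair D Θ α).2

theorem derivedRing_zero (D : Subring K) (Θ : Set (Subring K)) :
    derivedRing D Θ (0 : Ordinal.{v}) = D := by
  simp [derivedRing, derivedPair]

theorem derivedFamily_zero (D : Subring K) (Θ : Set (Subring K)) :
    derivedFamily D Θ (0 : Ordinal.{v}) = Θ := by
  simp [derivedFamily, derivedPair]

theorem derivedFamily_add_one (D : Subring K) (Θ : Set (Subring K)) (γ : Ordinal.{v}) :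
    derivedFamily D Θ (γ + 1) =
      derivedFamily D Θ γ \ jaffardPart (derivedRing D Θ γ) (derivedFamily D Θ γ) := by
  simp [derivedFamily, derivedRing, derivedPair]

theorem derivedFamily_limit (D : Subring K) (Θ : Set (Subring K)) {α : Ordinal.{v}}
    (hα : Order.IsSuccLimit α) :
    derivedFamily D Θ α = ⋂ β < α, derivedFamily D Θ β := by
  simp [derivedFamily, derivedPair, Ordinal.limitRecOn_limit _ _ _ _ hα]

theorem derivedRing_of_ne_zero (D : Subring K) (Θ : Set (Subring K)) {α : Ordinal.{v}}
    (hα : α ≠ 0) : derivedRing D Θ α = sInf (derivedFamily D Θ α) := by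
  induction α using Ordinal.limitRecOn with
  | zero => exact absurd rfl hα
  | add_one γ _ => simp [derivedFamily, derivedRing, derivedPair]
  | limit α h _ =>
    simp [derivedFamily, derivedRing, derivedPair, Ordinal.limitRecOn_limit _ _ _ _ h]

end JaffardFamilies

open JaffardFamilies

namespace JaffardFamilies

variable {K : Type u} [Field K]

/-! The heart of the matter is compactness. Suppose `K ∉ Θ`, let `Θ' ⊆ Θ` be compact and put `R = ⋂
Θ'`. For `T ∈ Θ \ Θ'`, independence makes the compositum of `T` with each member of `Θ'` equal to
`K`, and compactness moves the extension to `T` inside the intersection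
(`isCarried_sInf_of_isCompact`), so `T R = K`. A nonzero prime contracted from `R` can therefore
survive only in members of `Θ'`. It follows that `R` is flat, that `Θ'`, if nonempty, is a
pre-Jaffard family of `R` (`IsFlatPartition.isPreJaffardFamily_sInf`), and that `R` can replace `Θ'`
inside `Θ`, which gives (b).

It remains to see that each `Θ_α` is compact. The transfinite induction carries a more stable
property, `IsClosedAwayFromInverses`: for every nonzero `a ∈ D`, the subfamily is relatively closed
among the members of `Θ` that omit `a⁻¹`. This suffices for compactness and survives arbitrary
intersections. It also survives the removal of Jaffard overrings, since each of these is isolated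
among the members omitting `a⁻¹` (`IsFlatPartition.exists_basicOpen`).

Composita are treated elementwise through `IsCarried`: for flat `T` and a `D`-submodule `X` of `K`,
being carried into `X` amounts to membership in `X T`. In particular, an overring `T` is flat
exactly when all its elements are carried into `D`. -/

/-- Every element of `K` is a fraction of elements of `D`. -/
def HasDenominators (D : Subring K) : Prop :=
  ∀ x : K, ∃ b ∈ D, b ≠ 0 ∧ b * x ∈ D

theorem hasDenominators_of_isFractionRing (D : Subring K) [IsFractionRing D K] :
    HasDenominators D := by
  intro x
  obtain ⟨a, b, hb, rfl⟩ := IsFractionRing.div_surjective (A := D) x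
  have hb0 : (b : K) ≠ 0 := by
    simpa using nonZeroDivisors.ne_zero hb
  refine ⟨b, b.2, hb0, ?_⟩
  have h : (b : K) * (algebraMap D K a / algebraMap D K b) = a := mul_div_cancel₀ (a : K) hb0
  rw [h]
  exact a.2

theorem HasDenominators.mono {D R : Subring K} (hD : HasDenominators D) (h : D ≤ R) :
    HasDenominators R := fun x =>
  let ⟨b, hb, hb0, hbx⟩ := hD x
  ⟨b, h hb, hb0, h hbx⟩

/-! ### Extension of ideals -/

theorem extension_eq_map {D T : Subring K} (h : D ≤ T) (I : Ideal D) :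
    extension I T = Submodule.map (Algebra.linearMap T K) (I.map (Subring.inclusion h)) := by
  rw [extension, Ideal.map, Ideal.span, Submodule.map_span, Set.image_image]
  rfl

theorem one_mem_extension_iff {D T : Subring K} (h : D ≤ T) (J : Ideal D) :
    (1 : K) ∈ extension J T ↔ J.map (Subring.inclusion h) = ⊤ := by
  rw [extension_eq_map h, Ideal.eq_top_iff_one]
  constructor
  · rintro ⟨y, hy, hy1⟩
    have : y = 1 := Subtype.ext hy1
    exact this ▸ hy
  · intro h1
    exact ⟨1, h1, rfl⟩

theorem extension_mono {D : Subring K} {I J : Ideal D} (h : I ≤ J) (T : Subring K) :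
    extension I T ≤ extension J T :=
  Submodule.span_mono (Set.image_mono h)

theorem coe_mem_extension {D : Subring K} {I : Ideal D} {d : D} (hd : d ∈ I) (T : Subring K) :
    (d : K) ∈ extension I T :=
  Submodule.subset_span ⟨d, hd, rfl⟩

theorem extension_subset_of_le {D : Subring K} (I : Ideal D) {S T : Subring K} (h : S ≤ T) :
    (extension I S : Set K) ⊆ extension I T := by
  intro x hx
  refine Submodule.span_induction (p := fun x _ => x ∈ extension I T) ?_ (zero_mem _)
    (fun _ _ _ _ => add_mem) (fun (s : S) y _ hy => ?_) hx
  · rintro _ ⟨d, hd, rfl⟩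
    exact coe_mem_extension hd T
  · exact (extension I T).smul_mem (⟨s, h s.2⟩ : T) hy

theorem one_mem_extension_mul {D T : Subring K} (h : D ≤ T) {I J : Ideal D}
    (hI : (1 : K) ∈ extension I T) (hJ : (1 : K) ∈ extension J T) :
    (1 : K) ∈ extension (I * J) T := by
  rw [one_mem_extension_iff h] at hI hJ ⊢
  rw [Ideal.map_mul, hI, hJ, Ideal.mul_top]

theorem one_mem_extension_top (D T : Subring K) : (1 : K) ∈ extension (⊤ : Ideal D) T :=
  coe_mem_extension (I := ⊤) (d := 1) trivial T

/-- An ideal of `D` that becomes trivial in `T` contains a finite set that generates `T`. -/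
theorem exists_finset_of_one_mem_extension {D T : Subring K} {J : Ideal D}
    (hJ : (1 : K) ∈ extension J T) :
    ∃ F : Finset K, (∀ x ∈ F, ∃ d ∈ J, (d : K) = x) ∧
      (1 : K) ∈ Submodule.span T (F : Set K) := by
  obtain ⟨F, hF, h1⟩ := Submodule.mem_span_finite_of_mem_span hJ
  exact ⟨F, fun x hx => hF hx, h1⟩

theorem exists_prime_over_of_one_notMem {D T : Subring K} (h : D ≤ T) {J : Ideal D}
    (hJ : (1 : K) ∉ extension J T) : ∃ P ∈ contractedPrimes h, J ≤ P.asIdeal := by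
  rw [one_mem_extension_iff h] at hJ
  obtain ⟨M, hM, hle⟩ := Ideal.exists_le_maximal _ hJ
  exact ⟨_, ⟨⟨M, hM.isPrime⟩, rfl⟩, Ideal.map_le_iff_le_comap.mp hle⟩

theorem one_notMem_extension_of_mem_contractedPrimes {D T : Subring K} {h : D ≤ T}
    {P : PrimeSpectrum D} (hP : P ∈ contractedPrimes h) :
    (1 : K) ∉ extension P.asIdeal T := by
  obtain ⟨Q, rfl⟩ := hP
  rw [one_mem_extension_iff h]
  intro h1
  exact Q.2.ne_top (top_le_iff.mp (h1 ▸ Ideal.map_le_iff_le_comap.mpr le_rfl))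

theorem bot_mem_contractedPrimes {D T : Subring K} (h : D ≤ T) : ⊥ ∈ contractedPrimes h := by
  refine ⟨⊥, PrimeSpectrum.ext ?_⟩
  exact Ideal.comap_bot_of_injective _ (Subring.inclusion_injective h)

/-- The primes of a flat overring are stable under generization. -/
theorem mem_contractedPrimes_of_le {D T : Subring K} (hT : IsFlatOverring D T) (h : D ≤ T)
    {P P' : PrimeSpectrum D} (hP : P ∈ contractedPrimes h) (hle : P' ≤ P) :
    P' ∈ contractedPrimes h := by
  obtain ⟨_, hf⟩ := hT
  obtain ⟨Q, rfl⟩ := hP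
  obtain ⟨Q', -, hQ'⟩ := hf.generalizingMap_comap ((PrimeSpectrum.le_iff_specializes _ _).mp hle)
  exact ⟨Q', hQ'⟩

/-- A prime of `T` above `P T` contracts to a prime containing `P`, and going-down descends to `P`
itself. So for flat `T`, lying in `σ(T)` can be tested by `P T ≠ T`. -/
theorem mem_contractedPrimes_of_one_notMem {D T : Subring K} (hT : IsFlatOverring D T)
    (h : D ≤ T) {P : PrimeSpectrum D} (hP : (1 : K) ∉ extension P.asIdeal T) :
    P ∈ contractedPrimes h :=
  let ⟨_, hQ, hle⟩ := exists_prime_over_of_one_notMem h hP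
  mem_contractedPrimes_of_le hT h hQ hle

/-! ### Elements that are carried into a set by an ideal that becomes trivial -/

/-- Some ideal `J` of `D` with `J T = T` carries `x` into `X`. -/
def IsCarried (D T : Subring K) (X : Set K) (x : K) : Prop :=
  ∃ J : Ideal D, (1 : K) ∈ extension J T ∧ ∀ d ∈ J, (d : K) * x ∈ X

theorem IsCarried.mono {D T : Subring K} {X Y : Set K} {x : K} (hx : IsCarried D T X x)
    (h : X ⊆ Y) : IsCarried D T Y x :=
  let ⟨J, hJ, hJx⟩ := hx
  ⟨J, hJ, fun d hd => h (hJx d hd)⟩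

theorem isCarried_of_forall {D : Subring K} (T : Subring K) {X : Set K} {x : K}
    (hx : ∀ d : D, (d : K) * x ∈ X) : IsCarried D T X x :=
  ⟨⊤, one_mem_extension_top D T, fun d _ => hx d⟩

theorem IsCarried.inter {D T : Subring K} (h : D ≤ T) {X Y : Set K} {x : K}
    (hX : IsCarried D T X x) (hY : IsCarried D T Y x) : IsCarried D T (X ∩ Y) x := by
  obtain ⟨I, hI, hIx⟩ := hX
  obtain ⟨J, hJ, hJx⟩ := hY
  refine ⟨I * J, one_mem_extension_mul h hI hJ, fun d hd => ?_⟩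
  have hd' : d ∈ I ⊓ J := Ideal.mul_le_inf hd
  exact ⟨hIx d hd'.1, hJx d hd'.2⟩

theorem IsCarried.exists_common {D T : Subring K} (h : D ≤ T) {X : Set K} {ι : Type*}
    (s : Finset ι) {x : ι → K} (hx : ∀ i ∈ s, IsCarried D T X (x i)) :
    ∃ J : Ideal D, (1 : K) ∈ extension J T ∧ ∀ d ∈ J, ∀ i ∈ s, (d : K) * x i ∈ X := by
  classical
  induction s using Finset.induction_on with
  | empty => exact ⟨⊤, one_mem_extension_top D T, by simp⟩
  | insert j s _ ih =>
    obtain ⟨I, hI, hIx⟩ := ih fun i hi => hx i (Finset.mem_insert_of_mem hi)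
    obtain ⟨J, hJ, hJx⟩ := hx j (Finset.mem_insert_self j s)
    refine ⟨I * J, one_mem_extension_mul h hI hJ, fun d hd i hi => ?_⟩
    have hd' : d ∈ I ⊓ J := Ideal.mul_le_inf hd
    rcases Finset.mem_insert.mp hi with rfl | hi
    · exact hJx d hd'.2
    · exact hIx d hd'.1 i hi

/-- If `T ≤ A`, then an element that is carried into `A` belongs to `A`. -/
theorem mem_of_one_mem_span {T A : Subring K} (hTA : T ≤ A) {X : Set K} {x : K}
    (hX : (1 : K) ∈ Submodule.span T X) (hx : ∀ d ∈ X, d * x ∈ A) : x ∈ A := by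
  have : (1 : K) * x ∈ A := by
    refine Submodule.span_induction (p := fun y _ => y * x ∈ A) hx (by simp)
      (fun y z _ _ hy hz => ?_) (fun t y _ hy => ?_) hX
    · rw [add_mul]
      exact add_mem hy hz
    · rw [Subring.smul_def, smul_eq_mul, mul_assoc]
      exact mul_mem (hTA t.2) hy
  rwa [one_mul] at this

theorem IsCarried.mem {D T A : Subring K} {x : K} (hTA : T ≤ A)
    (hx : IsCarried D T A x) : x ∈ A := by
  obtain ⟨J, hJ, hJx⟩ := hx
  refine mem_of_one_mem_span hTA hJ ?_
  rintro _ ⟨d, hd, rfl⟩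
  exact hJx d hd

theorem mul_mem_of_mem_span {D R : Subring K} (h : D ≤ R) {X : Set D} {x : K}
    (hX : ∀ d ∈ X, (d : K) * x ∈ R) {d : D} (hd : d ∈ Ideal.span X) : (d : K) * x ∈ R := by
  refine Submodule.span_induction (p := fun (d : D) _ => (d : K) * x ∈ R) hX
    (by simp) (fun y z _ _ hy hz => ?_) (fun c y _ hy => ?_) hd
  · rw [Subring.coe_add, add_mul]
    exact add_mem hy hz
  · rw [smul_eq_mul, Subring.coe_mul, mul_assoc]
    exact mul_mem (h c.2) hy

/-! ### Flat overrings -/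

/-- The equational criterion for flatness, applied to the relation `a • 1 - b • t = 0`. Of the two
resulting expansions only that of `1` is kept. -/
theorem exists_sum_smul_eq_one_of_flat {R S : Type*} [CommRing R] [CommRing S] [Algebra R S]
    [Module.Flat R S] {a b : R} {t : S} (h : a • (1 : S) = b • t) :
    ∃ (k : ℕ) (c c' : Fin k → R) (y : Fin k → S), ∑ j, c j • y j = 1 ∧
      ∀ j, a * c j = b * c' j := by
  have hrel : ∑ i, (![a, -b] : Fin 2 → R) i • (![1, t] : Fin 2 → S) i = 0 := by
    simp [Fin.sum_univ_two, h]
  obtain ⟨k, c, y, hcy, hc⟩ :=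
    Module.Flat.isTrivialRelation_of_sum_smul_eq_zero (R := R) (M := S) hrel
  refine ⟨k, c 0, c 1, y, (hcy 0).symm, fun j => ?_⟩
  have h2 := hc j
  simp only [Fin.sum_univ_two, Matrix.cons_val_zero, Matrix.cons_val_one] at h2
  linear_combination h2

theorem IsFlatOverring.exists_sum_eq_one {D T : Subring K} (hD : HasDenominators D)
    (hT : IsFlatOverring D T) {t : K} (ht : t ∈ T) :
    ∃ (k : ℕ) (a : Fin k → D) (y : Fin k → T), ∑ j, (y j : K) * (a j : K) = 1 ∧
      ∀ j, (a j : K) * t ∈ D := by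
  obtain ⟨h, hf⟩ := hT
  let _ : Algebra D T := (Subring.inclusion h).toAlgebra
  have : Module.Flat D T := hf
  obtain ⟨b, hb, hb0, hbt⟩ := hD t
  have hrel : (⟨b * t, hbt⟩ : D) • (1 : T) = (⟨b, hb⟩ : D) • (⟨t, ht⟩ : T) :=
    Subtype.ext (mul_one (b * t))
  obtain ⟨k, a, a', y, hay, ha⟩ := exists_sum_smul_eq_one_of_flat hrel
  refine ⟨k, a, y, ?_, fun j => ?_⟩
  · have h0 := congrArg T.subtype hay
    rw [map_sum] at h0
    refine Eq.trans (Finset.sum_congr rfl fun j _ => ?_) h0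
    exact mul_comm _ _
  · have h2 : b * t * (a j : K) = b * (a' j : K) := congrArg D.subtype (ha j)
    have h3 : (a j : K) * t = a' j := by
      apply mul_left_cancel₀ hb0
      linear_combination h2
    rw [h3]
    exact (a' j).2

theorem IsFlatOverring.isCarried {D T : Subring K} (hD : HasDenominators D)
    (hT : IsFlatOverring D T) {t : K} (ht : t ∈ T) : IsCarried D T D t := by
  obtain ⟨k, a, y, hsum, ha⟩ := hT.exists_sum_eq_one hD ht
  refine ⟨Ideal.span (Set.range a), ?_, fun d hd => mul_mem_of_mem_span le_rfl ?_ hd⟩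
  · rw [← hsum]
    exact sum_mem fun j _ => (extension _ T).smul_mem (y j)
      (coe_mem_extension (Ideal.subset_span (Set.mem_range_self j)) T)
  · rintro _ ⟨j, rfl⟩
    exact ha j

theorem isFlatOverring_of_isCarried {D T : Subring K} (h : D ≤ T)
    (hT : ∀ t ∈ T, IsCarried D T D t) : IsFlatOverring D T := by
  refine ⟨h, ?_⟩
  let _ : Algebra D T := (Subring.inclusion h).toAlgebra
  show Module.Flat D T
  refine Module.Flat.of_forall_isTrivialRelation fun {l f x} hfx => ?_
  obtain ⟨J, hJ, hJx⟩ := IsCarried.exists_common h Finset.univ (X := D)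
    (x := fun i : Fin l => (x i : K)) fun i _ => hT _ (x i).2
  -- `J` clears the denominators of all `x i` at once. From `1 = ∑ c j * e j` with `e j ∈ J` comes
  -- `x i = ∑ (e j * x i) * c j`, whose coefficients lie in `D` and inherit the relation from the `x
  -- i`.
  obtain ⟨n, c, g, hg⟩ := Submodule.mem_span_set'.mp hJ
  choose e he hec using fun j => (g j).2
  refine ⟨n, fun i j => ⟨e j * x i, hJx _ (he j) i (Finset.mem_univ i)⟩, c, fun i => ?_,
    fun j => ?_⟩
  · apply Subtype.ext
    have h1 : ∑ j, (c j : K) * (e j : K) = 1 := by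
      rw [← hg]
      refine Finset.sum_congr rfl fun j _ => ?_
      rw [← hec j]
      rfl
    rw [← T.subtype_apply, ← T.subtype_apply, map_sum]
    calc (x i : K) = ∑ j, (c j : K) * (e j : K) * x i := by rw [← Finset.sum_mul, h1, one_mul]
      _ = _ := Finset.sum_congr rfl fun j _ => by
        rw [Algebra.smul_def, map_mul]
        show _ = ((e j : K) * x i) * c j
        ring
  · apply Subtype.ext
    have h2 : ∑ i, (f i : K) * (x i : K) = 0 := by
      have := congrArg T.subtype hfx
      rw [map_sum, map_zero] at this
      exact this
    rw [← D.subtype_apply, ← D.subtype_apply, map_sum, map_zero]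
    calc ∑ i, D.subtype (f i * ⟨e j * x i, hJx _ (he j) i (Finset.mem_univ i)⟩)
        = ∑ i, (e j : K) * ((f i : K) * (x i : K)) := Finset.sum_congr rfl fun i _ => by
          rw [map_mul]
          show (f i : K) * ((e j : K) * x i) = _
          ring
      _ = 0 := by rw [← Finset.mul_sum, h2, mul_zero]

theorem one_mem_extension_comap {D R T : Subring K} {J : Ideal D} {J' : Ideal R}
    (hJ : (1 : K) ∈ extension J T) (h : ∀ d ∈ J, ∃ e ∈ J', (e : K) = d) :
    (1 : K) ∈ extension J' T := by
  refine Submodule.span_mono ?_ hJ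
  rintro _ ⟨d, hd, rfl⟩
  exact h d hd

theorem IsCarried.of_le {D R T : Subring K} (hDR : D ≤ R) {x : K}
    (hx : IsCarried D T D x) : IsCarried R T R x := by
  obtain ⟨J, hJ, hJx⟩ := hx
  refine ⟨J.map (Subring.inclusion hDR), one_mem_extension_comap hJ fun d hd =>
    ⟨_, Ideal.mem_map_of_mem _ hd, rfl⟩, fun d hd => ?_⟩
  refine mul_mem_of_mem_span le_rfl ?_ hd
  rintro _ ⟨e, he, rfl⟩
  exact hDR (hJx e he)

theorem IsFlatOverring.of_le {D R T : Subring K} (hD : HasDenominators D)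
    (hT : IsFlatOverring D T) (hDR : D ≤ R) (hRT : R ≤ T) : IsFlatOverring R T :=
  isFlatOverring_of_isCarried hRT fun _ ht => (hT.isCarried hD ht).of_le hDR

/-! ### Colon ideals -/

/-- The ideal of the elements of `D` that carry `x` into the overring `A`. -/
def colonIdeal {D A : Subring K} (h : D ≤ A) (x : K) : Ideal D where
  carrier := {d | (d : K) * x ∈ A}
  zero_mem' := by simp
  add_mem' {c d} hc hd := by
    show ((c + d : D) : K) * x ∈ A
    rw [Subring.coe_add, add_mul]
    exact add_mem hc hd
  smul_mem' c d hd := by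
    show ((c * d : D) : K) * x ∈ A
    rw [Subring.coe_mul, mul_assoc]
    exact mul_mem (h c.2) hd

theorem mem_colonIdeal {D A : Subring K} {h : D ≤ A} {x : K} {d : D} :
    d ∈ colonIdeal h x ↔ (d : K) * x ∈ A := Iff.rfl

/-- The ideal of the elements of `D` that carry `x` into the ideal `I`. -/
def idealColon {D : Subring K} (I : Ideal D) (x : K) : Ideal D :=
  (Submodule.map (Algebra.linearMap D K) I).comap (LinearMap.toSpanSingleton D K x)

theorem mem_idealColon {D : Subring K} {I : Ideal D} {x : K} {d : D} :
    d ∈ idealColon I x ↔ (d : K) * x ∈ (fun y : D => (y : K)) '' (I : Set D) := Iff.rfl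

/-- Flatness enters only for scalars: if `J` carries `a` into `D`, then `J * (I : y)` is contained
in `(I : a y)`. -/
theorem one_mem_extension_idealColon {D A : Subring K} (hD : HasDenominators D)
    (hA : IsFlatOverring D A) {I : Ideal D} {x : K} (hx : x ∈ extension I A) :
    (1 : K) ∈ extension (idealColon I x) A := by
  have hDA : D ≤ A := hA.1
  refine Submodule.span_induction (p := fun x _ => (1 : K) ∈ extension (idealColon I x) A)
    ?_ ?_ (fun y z _ _ hy hz => ?_) (fun a y _ hy => ?_) hx
  · rintro _ ⟨i, hi, rfl⟩
    exact extension_mono (fun d _ => mem_idealColon.mpr ⟨d * i, I.mul_mem_left d hi, rfl⟩) A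
      (one_mem_extension_top D A)
  · exact extension_mono (fun d _ => mem_idealColon.mpr ⟨0, I.zero_mem, by simp⟩) A
      (one_mem_extension_top D A)
  · refine extension_mono (fun d hd => ?_) A (one_mem_extension_mul hDA hy hz)
    have hd' : d ∈ idealColon I y ⊓ idealColon I z := Ideal.mul_le_inf hd
    obtain ⟨i, hi, hiy⟩ := mem_idealColon.mp hd'.1
    obtain ⟨j, hj, hjz⟩ := mem_idealColon.mp hd'.2
    refine mem_idealColon.mpr ⟨i + j, I.add_mem hi hj, ?_⟩
    rw [mul_add, ← hiy, ← hjz]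
    rfl
  · obtain ⟨J, hJ, hJa⟩ := hA.isCarried hD a.2
    refine extension_mono (Ideal.mul_le.mpr fun e he f hf => ?_) A
      (one_mem_extension_mul hDA hJ hy)
    obtain ⟨i, hi, hiy⟩ := mem_idealColon.mp hf
    refine mem_idealColon.mpr ⟨⟨_, hJa e he⟩ * i, I.mul_mem_left _ hi, ?_⟩
    show (e : K) * a * i = (e * f : K) * (a * y)
    have hiy' : (i : K) = f * y := hiy
    rw [hiy']
    ring

/-! ### Contracted primes and composita -/

/-- If the flat overring `T` and the overring `A` of `D` have only the zero prime in common, then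
their compositum is `K`. -/
theorem isCarried_inv_of_inter_eq_bot {D A T : Subring K} (hA : D ≤ A) (h : D ≤ T)
    (hT : IsFlatOverring D T) (hAT : contractedPrimes hA ∩ contractedPrimes h = {⊥})
    {a : K} (ha : a ∈ D) (ha0 : a ≠ 0) : IsCarried D T A a⁻¹ := by
  refine ⟨colonIdeal hA a⁻¹, ?_, fun d hd => hd⟩
  by_contra h1
  obtain ⟨P, hP, hle⟩ := exists_prime_over_of_one_notMem h h1
  -- A relation `d = c * a` with `d ∉ P` would put `d` in the colon ideal, which lies in `P`. So
  -- some prime of `A` contains `a` and contracts into `P`; by generization its contraction is in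
  -- both spectra, yet contains `a ≠ 0`.
  have hdisj : Disjoint ((Ideal.span {(⟨a, hA ha⟩ : A)} : Ideal A) : Set A)
      (P.asIdeal.primeCompl.map (Subring.inclusion hA)) := by
    rw [Set.disjoint_left]
    rintro _ hspan ⟨d, hd, rfl⟩
    obtain ⟨c, hc⟩ := Ideal.mem_span_singleton'.mp hspan
    refine hd (hle (mem_colonIdeal.mpr ?_))
    have hc' : (c : K) * a = d := congrArg A.subtype hc
    rw [← hc', mul_inv_cancel_right₀ ha0]
    exact c.2
  obtain ⟨Q, hQ, haQ, hQP⟩ := Ideal.exists_le_prime_disjoint _ _ hdisj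
  have hP'P : PrimeSpectrum.comap (Subring.inclusion hA) ⟨Q, hQ⟩ ≤ P := by
    intro d hd
    by_contra hdP
    exact Set.disjoint_left.mp hQP hd ⟨d, hdP, rfl⟩
  have hbot : PrimeSpectrum.comap (Subring.inclusion hA) ⟨Q, hQ⟩ ∈ ({⊥} : Set _) :=
    hAT ▸ ⟨⟨_, rfl⟩, mem_contractedPrimes_of_le hT h hP hP'P⟩
  have haP' : (⟨a, ha⟩ : D) ∈ (PrimeSpectrum.comap (Subring.inclusion hA) ⟨Q, hQ⟩).asIdeal :=
    haQ (Ideal.mem_span_singleton_self _)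
  rw [Set.mem_singleton_iff.mp hbot] at haP'
  exact ha0 (congrArg D.subtype (show (⟨a, ha⟩ : D) = 0 from haP'))

theorem exists_mem_ne_zero_of_ne_bot {D : Subring K} {P : PrimeSpectrum D} (hP : P ≠ ⊥) :
    ∃ a ∈ P.asIdeal, (a : K) ≠ 0 := by
  by_contra! h
  refine hP (PrimeSpectrum.ext (le_antisymm (fun a ha => ?_) bot_le))
  exact Subtype.ext (h a ha)

/-- If `Q` in `R` contracts to `P` and `0 ≠ a ∈ P`, an ideal `J` carrying `a⁻¹` into `R` lies in
`P`, because `d = (d a⁻¹) a ∈ Q`. Then `J T = T` prevents `P` from surviving in `T`. -/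
theorem inter_eq_bot_of_forall_isCarried_inv {D R T : Subring K} (hR : D ≤ R) (h : D ≤ T)
    (hTR : ∀ a ∈ D, a ≠ 0 → IsCarried D T R a⁻¹) :
    contractedPrimes h ∩ contractedPrimes hR = {⊥} := by
  refine subset_antisymm ?_ (Set.singleton_subset_iff.mpr
    ⟨bot_mem_contractedPrimes h, bot_mem_contractedPrimes hR⟩)
  rintro P ⟨hPT, ⟨Q, rfl⟩⟩
  by_contra hP
  obtain ⟨a, haP, ha0⟩ := exists_mem_ne_zero_of_ne_bot hP
  obtain ⟨J, hJ, hJa⟩ := hTR a a.2 ha0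
  refine one_notMem_extension_of_mem_contractedPrimes hPT (extension_mono (fun d hd => ?_) T hJ)
  have : Subring.inclusion hR d = ⟨_, hJa d hd⟩ * Subring.inclusion hR a :=
    Subtype.ext (inv_mul_cancel_right₀ ha0 (d : K)).symm
  show Subring.inclusion hR d ∈ Q.asIdeal
  rw [this]
  exact Q.asIdeal.mul_mem_left _ haP

theorem eq_bot_of_comap_eq_bot {D R : Subring K} (hD : HasDenominators D) (h : D ≤ R)
    {Q : PrimeSpectrum R} (hQ : PrimeSpectrum.comap (Subring.inclusion h) Q = ⊥) : Q = ⊥ := by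
  by_contra hne
  obtain ⟨x, hx, hx0⟩ := exists_mem_ne_zero_of_ne_bot hne
  obtain ⟨b, hb, hb0, hbx⟩ := hD x
  have hmem : (⟨b * x, hbx⟩ : D) ∈ (PrimeSpectrum.comap (Subring.inclusion h) Q).asIdeal :=
    Q.asIdeal.mul_mem_left ⟨b, h hb⟩ hx
  rw [hQ] at hmem
  have : b * (x : K) = 0 := congrArg D.subtype (show (⟨b * x, hbx⟩ : D) = 0 from hmem)
  exact mul_ne_zero hb0 hx0 this

/-! ### Compact families -/

attribute [local instance] zariskiTopology

theorem isOpen_basicOpen (F : Finset K) : IsOpen (basicOpen F) :=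
  TopologicalSpace.isOpen_generateFrom_of_mem ⟨F, rfl⟩

/-- Extension to `T` commutes with the intersection of a compact family of overrings. -/
theorem isCarried_sInf_of_isCompact {D T : Subring K} (h : D ≤ T) {Λ : Set (Subring K)}
    (hΛ : ∀ A ∈ Λ, D ≤ A) (hc : IsZariskiCompact Λ) {x : K}
    (hx : ∀ A ∈ Λ, IsCarried D T A x) : IsCarried D T (sInf Λ : Subring K) x := by
  classical
  suffices IsCarried D T {y | ∀ A ∈ Λ, y ∈ A} x from
    this.mono fun y hy => Subring.mem_sInf.mpr hy
  refine IsCompact.induction_on (p := fun Λ => IsCarried D T {y | ∀ A ∈ Λ, y ∈ A} x) hc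
    (isCarried_of_forall T (by simp)) (fun s t hst ht => ht.mono fun y hy A hA => hy A (hst hA))
    (fun s t hs ht => (hs.inter h ht).mono ?_) (fun A hA => ?_)
  · rintro y ⟨hy, hy'⟩ A (hA | hA)
    exacts [hy A hA, hy' A hA]
  · obtain ⟨J, hJ, hJx⟩ := hx A hA
    -- A finite part `F` of `J` already generates the unit ideal of `T`, so carrying `x` into a ring
    -- by means of `F` is an open condition on that ring.
    obtain ⟨F, hF, hF1⟩ := exists_finset_of_one_mem_extension hJ
    refine ⟨Λ ∩ basicOpen (F.image (· * x)), inter_mem_nhdsWithin _ ((isOpen_basicOpen _).mem_nhds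
      ?_), Ideal.span {d | (d : K) ∈ F}, ?_, ?_⟩
    · intro y hy
      obtain ⟨f, hf, rfl⟩ := Finset.mem_image.mp hy
      obtain ⟨d, hd, rfl⟩ := hF f hf
      exact hJx d hd
    · refine Submodule.span_mono ?_ hF1
      intro f hf
      obtain ⟨d, hd, rfl⟩ := hF f hf
      exact ⟨d, Ideal.subset_span hf, rfl⟩
    · rintro d hd B ⟨hB, hBF⟩
      exact mul_mem_of_mem_span (hΛ B hB)
        (fun e he => hBF _ (Finset.mem_image_of_mem _ he)) hd

/-- Away from each `a⁻¹`, the set `Θ'` is closed in `Θ`. -/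
def IsClosedAwayFromInverses (D : Subring K) (Θ Θ' : Set (Subring K)) : Prop :=
  ∀ a ∈ D, a ≠ 0 → ∃ U : Set (Subring K), IsOpen U ∧ ∀ A ∈ Θ, a⁻¹ ∉ A → (A ∈ Θ' ↔ A ∉ U)

/-- Take an ultrafilter on `Θ'`. If for some `a` it concentrates on rings omitting `a⁻¹`, it lives
on a closed part of `Θ` contained in `Θ'` and converges there. Otherwise it contains `{B | b⁻¹ ∈ B}`
for every nonzero `b ∈ D`, hence every basic open set, and converges to every point. -/
theorem IsClosedAwayFromInverses.isZariskiCompact {D : Subring K} (hD : HasDenominators D)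
    {Θ Θ' : Set (Subring K)} (hΘ : ∀ A ∈ Θ, D ≤ A) (hc : IsZariskiCompact Θ) (hsub : Θ' ⊆ Θ)
    (h : IsClosedAwayFromInverses D Θ Θ') : IsZariskiCompact Θ' := by
  refine isCompact_iff_ultrafilter_le_nhds.mpr fun f hf => ?_
  have hfΘ' : Θ' ∈ f := Filter.le_principal_iff.mp hf
  by_cases hV : ∃ a ∈ D, a ≠ 0 ∧ {A : Subring K | a⁻¹ ∉ A} ∈ f
  · obtain ⟨a, ha, ha0, haf⟩ := hV
    obtain ⟨U, hU, hUA⟩ := h a ha ha0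
    have hcpt : IsCompact (Θ \ (U ∪ basicOpen {a⁻¹})) :=
      IsCompact.diff hc (hU.union (isOpen_basicOpen _))
    have hmem : Θ \ (U ∪ basicOpen {a⁻¹}) ∈ f := by
      filter_upwards [hfΘ', haf] with A hA haA
      refine ⟨hsub hA, ?_⟩
      rintro (hAU | hAa)
      · exact (hUA A (hsub hA) haA).mp hA hAU
      · exact haA (hAa _ (Finset.mem_singleton_self _))
    obtain ⟨A, ⟨hA, hAU⟩, hfA⟩ :=
      isCompact_iff_ultrafilter_le_nhds.mp hcpt f (Filter.le_principal_iff.mpr hmem)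
    refine ⟨A, (hUA A hA fun haA => hAU (Or.inr ?_)).mpr fun hU' => hAU (Or.inl hU'), hfA⟩
    intro y hy
    rwa [Finset.mem_singleton.mp hy]
  · push Not at hV
    obtain ⟨A, hA⟩ := f.nonempty_of_mem hfΘ'
    refine ⟨A, hA, ?_⟩
    have hall : ∀ x : K, {B : Subring K | x ∈ B} ∈ f := by
      intro x
      obtain ⟨b, hb, hb0, hbx⟩ := hD x
      have hbf : {B : Subring K | b⁻¹ ∈ B} ∈ f := by
        have := Ultrafilter.compl_mem_iff_notMem.mpr (hV b hb hb0)
        filter_upwards [this] with B hB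
        exact not_not.mp hB
      filter_upwards [hfΘ', hbf] with B hB hbB
      have := mul_mem hbB (hΘ B (hsub hB) hbx)
      rwa [inv_mul_cancel_left₀ hb0] at this
    rw [TopologicalSpace.nhds_generateFrom]
    refine le_iInf₂ fun s hs => ?_
    obtain ⟨-, F, rfl⟩ := hs
    refine Filter.le_principal_iff.mpr ?_
    have := (Filter.biInter_finset_mem F (f := (f : Filter (Subring K)))
      (s := fun x : K => {B : Subring K | x ∈ B})).mpr fun x _ => hall x
    filter_upwards [this] with B hB x hx
    exact Set.mem_iInter₂.mp hB x hx

theorem isClosedAwayFromInverses_refl (D : Subring K) (Θ : Set (Subring K)) :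
    IsClosedAwayFromInverses D Θ Θ :=
  fun _ _ _ => ⟨∅, isOpen_empty, fun A hA _ => by simpa using hA⟩

/-- This carries the induction through limit ordinals; compactness alone is not inherited by
intersections in general. -/
theorem IsClosedAwayFromInverses.iInter {D : Subring K} {Θ : Set (Subring K)} {ι : Sort*}
    {Θ' : ι → Set (Subring K)} (h : ∀ i, IsClosedAwayFromInverses D Θ (Θ' i)) :
    IsClosedAwayFromInverses D Θ (⋂ i, Θ' i) := by
  intro a ha ha0
  choose U hU hUA using fun i => h i a ha ha0
  refine ⟨⋃ i, U i, isOpen_iUnion hU, fun A hA haA => ?_⟩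
  rw [Set.mem_iInter, Set.mem_iUnion, not_exists]
  exact forall_congr' fun i => hUA i A hA haA

/-! ### Complete independent families of flat overrings -/

/-- Complete and independent families of proper flat overrings. -/
structure IsFlatPartition (D : Subring K) (Θ : Set (Subring K)) : Prop where
  overring : ∀ T ∈ Θ, D ≤ T
  top_notMem : ⊤ ∉ Θ
  flat : ∀ T ∈ Θ, IsFlatOverring D T
  independent : IsIndependentFamily D Θ
  complete : IsCompleteFamily D Θ

theorem IsPreJaffardFamily.isFlatPartition {D : Subring K} {Θ : Set (Subring K)}
    (hΘ : IsPreJaffardFamily D Θ) (htop : ⊤ ∉ Θ) : IsFlatPartition D Θ :=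
  ⟨hΘ.overring, htop, hΘ.flat, hΘ.independent, hΘ.complete⟩

theorem IsCompleteFamily.exists_one_notMem {D : Subring K} {Θ : Set (Subring K)}
    (hΘ : IsCompleteFamily D Θ) {P : Ideal D} (hP : P ≠ ⊤) :
    ∃ T ∈ Θ, (1 : K) ∉ extension P T := by
  by_contra! h
  have h1 : (1 : K) ∈ (fun x : D => (x : K)) '' (P : Set D) := by
    rw [hΘ P]
    exact Set.mem_iInter₂.mpr h
  obtain ⟨d, hd, hd1⟩ := h1
  exact hP ((Ideal.eq_top_iff_one P).mpr ((show d = 1 from Subtype.ext hd1) ▸ hd))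

/-- The compositum of `⋂ Θ'` with each member of `Θ` outside `Θ'` is `K`. -/
def IsSeparatedSubfamily (D : Subring K) (Θ Θ' : Set (Subring K)) : Prop :=
  ∀ T ∈ Θ, T ∉ Θ' → ∀ a ∈ D, a ≠ 0 → IsCarried D T (sInf Θ' : Subring K) a⁻¹

theorem IsFlatPartition.isSeparatedSubfamily {D : Subring K} {Θ Θ' : Set (Subring K)}
    (hΘ : IsFlatPartition D Θ) (hsub : Θ' ⊆ Θ) (hc : IsZariskiCompact Θ') :
    IsSeparatedSubfamily D Θ Θ' := fun T hT hTΘ' _ ha ha0 =>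
  isCarried_sInf_of_isCompact (hΘ.overring T hT) (fun A hA => hΘ.overring A (hsub hA)) hc
    fun A hA => isCarried_inv_of_inter_eq_bot (hΘ.overring A (hsub hA)) (hΘ.overring T hT)
      (hΘ.flat T hT) (hΘ.independent A (hsub hA) T hT (fun h => hTΘ' (h ▸ hA)) _ _) ha ha0

theorem le_sInf_of_subset {D : Subring K} {Θ Θ' : Set (Subring K)}
    (hΘ : ∀ T ∈ Θ, D ≤ T) (hsub : Θ' ⊆ Θ) : D ≤ sInf Θ' :=
  le_sInf fun A hA => hΘ A (hsub hA)

/-- A nonzero prime contracted from `⋂ Θ'` survives in a member of `Θ'`. -/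
theorem IsSeparatedSubfamily.exists_one_notMem {D : Subring K} {Θ Θ' : Set (Subring K)}
    (h : IsSeparatedSubfamily D Θ Θ') (hΘ : IsFlatPartition D Θ) (hR : D ≤ sInf Θ')
    {P : PrimeSpectrum D} (hP : P ∈ contractedPrimes hR) (hP0 : P ≠ ⊥) :
    ∃ T ∈ Θ, T ∈ Θ' ∧ (1 : K) ∉ extension P.asIdeal T := by
  obtain ⟨T, hT, hPT⟩ := hΘ.complete.exists_one_notMem P.2.ne_top
  refine ⟨T, hT, ?_, hPT⟩
  by_contra hTΘ'
  have hbot : P ∈ ({⊥} : Set _) :=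
    inter_eq_bot_of_forall_isCarried_inv hR (hΘ.overring T hT) (h T hT hTΘ') ▸
      ⟨mem_contractedPrimes_of_one_notMem (hΘ.flat T hT) _ hPT, hP⟩
  exact hP0 hbot

theorem ne_bot_of_colonIdeal_le {D : Subring K} (hD : HasDenominators D) {x : K}
    {P : PrimeSpectrum D} (h : colonIdeal (le_refl D) x ≤ P.asIdeal) : P ≠ ⊥ := by
  rintro rfl
  obtain ⟨b, hb, hb0, hbx⟩ := hD x
  have : (⟨b, hb⟩ : D) ∈ (⊥ : PrimeSpectrum D).asIdeal := h (mem_colonIdeal.mpr hbx)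
  exact hb0 (congrArg D.subtype (show (⟨b, hb⟩ : D) = 0 from this))

theorem IsFlatOverring.one_mem_extension_colonIdeal {D T : Subring K} (hD : HasDenominators D)
    (hT : IsFlatOverring D T) {x : K} (hx : x ∈ T) :
    (1 : K) ∈ extension (colonIdeal (le_refl D) x) T := by
  obtain ⟨J, hJ, hJx⟩ := hT.isCarried hD hx
  exact extension_mono hJx T hJ

/-- If `(D : s)` did not blow up in `⋂ Θ'`, a nonzero prime above it would survive in some `T ∈ Θ'`;
but `s ∈ T` and `T` is flat. -/
theorem IsSeparatedSubfamily.isFlatOverring_sInf {D : Subring K} {Θ Θ' : Set (Subring K)}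
    (h : IsSeparatedSubfamily D Θ Θ') (hD : HasDenominators D) (hΘ : IsFlatPartition D Θ)
    (hsub : Θ' ⊆ Θ) : IsFlatOverring D (sInf Θ') := by
  have hR := le_sInf_of_subset hΘ.overring hsub
  refine isFlatOverring_of_isCarried hR fun s hs => ⟨colonIdeal le_rfl s, ?_, fun d hd => hd⟩
  by_contra h1
  obtain ⟨P, hP, hle⟩ := exists_prime_over_of_one_notMem hR h1
  obtain ⟨T, hT, hTΘ', hPT⟩ := h.exists_one_notMem hΘ hR hP (ne_bot_of_colonIdeal_le hD hle)
  exact hPT (extension_mono hle T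
    ((hΘ.flat T hT).one_mem_extension_colonIdeal hD (Subring.mem_sInf.mp hs T hTΘ')))

/-- If the prime `Q ∩ D` of `D` survives in the flat overring `T`, then so does `Q`. -/
theorem one_notMem_extension_of_comap {D R T : Subring K} (hD : HasDenominators D)
    (hR : D ≤ R) (hT : IsFlatOverring D T) {Q : PrimeSpectrum R}
    (hQ : (1 : K) ∉ extension (PrimeSpectrum.comap (Subring.inclusion hR) Q).asIdeal T) :
    (1 : K) ∉ extension Q.asIdeal T := by
  intro h1
  obtain ⟨n, c, g, hg⟩ := Submodule.mem_span_set'.mp h1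
  choose q hq hqg using fun j => (g j).2
  obtain ⟨J, hJ, hJc⟩ := IsCarried.exists_common hT.1 Finset.univ (X := D)
    (x := fun j => (c j : K)) fun j _ => hT.isCarried hD (c j).2
  -- For `d ∈ J`, multiplying `1 = ∑ c j * q j` by `d` gives coefficients `d * c j` in `D`, so `d ∈
  -- Q`. Thus `J ≤ Q ∩ D`.
  refine hQ (extension_mono (fun d hd => ?_) T hJ)
  have hsum : Subring.inclusion hR d =
      ∑ j, Subring.inclusion hR ⟨_, hJc d hd j (Finset.mem_univ j)⟩ * q j := by
    apply Subtype.ext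
    rw [← R.subtype_apply, ← R.subtype_apply, map_sum]
    calc (d : K) = d * ∑ j, c j • (g j : K) := by rw [hg, mul_one]
      _ = _ := by
        rw [Finset.mul_sum]
        refine Finset.sum_congr rfl fun j _ => ?_
        rw [← hqg j, map_mul]
        exact (mul_assoc (d : K) (c j) (q j)).symm
  show Subring.inclusion hR d ∈ Q.asIdeal
  rw [hsum]
  exact sum_mem fun j _ => Q.asIdeal.mul_mem_left _ (hq j)

theorem image_subset_iInter_extension {D : Subring K} (Θ : Set (Subring K)) (I : Ideal D) :
    (fun x : D => (x : K)) '' (I : Set D) ⊆ ⋂ T ∈ Θ, (extension I T : Set K) :=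
  Set.subset_iInter₂ fun _ _ => Submodule.subset_span

theorem isCompleteFamily_of_forall_prime {R : Subring K} (hR : HasDenominators R) {Θ : Set (Subring K)}
    (hflat : ∀ T ∈ Θ, IsFlatOverring R T)
    (hmax : ∀ Q : PrimeSpectrum R, ∃ T ∈ Θ, (1 : K) ∉ extension Q.asIdeal T) :
    IsCompleteFamily R Θ := by
  intro I
  refine subset_antisymm (image_subset_iInter_extension Θ I) fun x hx => ?_
  have hxT := Set.mem_iInter₂.mp hx
  suffices idealColon I x = ⊤ by
    have h1 : (1 : R) ∈ idealColon I x := this ▸ Submodule.mem_top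
    have := mem_idealColon.mp h1
    rwa [Subring.coe_one, one_mul] at this
  by_contra hne
  obtain ⟨M, hM, hle⟩ := Ideal.exists_le_maximal _ hne
  obtain ⟨T, hT, hMT⟩ := hmax ⟨M, hM.isPrime⟩
  exact hMT (extension_mono hle T (one_mem_extension_idealColon hR (hflat T hT) (hxT T hT)))

/-- A nonempty compact subfamily of a flat partition is a pre-Jaffard family of its
intersection. -/
theorem IsFlatPartition.isPreJaffardFamily_sInf {D : Subring K} (hD : HasDenominators D)
    {Θ Θ' : Set (Subring K)} (hΘ : IsFlatPartition D Θ) (hsub : Θ' ⊆ Θ) (hne : Θ'.Nonempty)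
    (hc : IsZariskiCompact Θ') : IsPreJaffardFamily (sInf Θ') Θ' := by
  have hR := le_sInf_of_subset hΘ.overring hsub
  have hsep := hΘ.isSeparatedSubfamily hsub hc
  have hflat : ∀ T ∈ Θ', IsFlatOverring (sInf Θ') T := fun T hT =>
    (hΘ.flat T (hsub hT)).of_le hD hR (sInf_le hT)
  refine ⟨fun T hT => sInf_le hT, Or.inl fun h => hΘ.top_notMem (hsub h), hflat, ?_, ?_, hc⟩
  · intro A hA B hB hAB hRA hRB
    refine subset_antisymm ?_ (Set.singleton_subset_iff.mpr
      ⟨bot_mem_contractedPrimes hRA, bot_mem_contractedPrimes hRB⟩)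
    rintro Q ⟨⟨QA, hQA⟩, ⟨QB, hQB⟩⟩
    refine eq_bot_of_comap_eq_bot hD hR ?_
    refine Set.mem_singleton_iff.mp (hΘ.independent A (hsub hA) B (hsub hB) hAB
      (hR.trans hRA) (hR.trans hRB) ▸ ⟨⟨QA, ?_⟩, ⟨QB, ?_⟩⟩)
    · rw [← hQA]
      rfl
    · rw [← hQB]
      rfl
  · refine isCompleteFamily_of_forall_prime (hD.mono hR) hflat fun Q => ?_
    -- The separation argument says nothing about the zero prime; this case is where `Θ'` must be
    -- nonempty.
    by_cases hQ : PrimeSpectrum.comap (Subring.inclusion hR) Q = ⊥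
    · obtain ⟨T, hT⟩ := hne
      refine ⟨T, hT, ?_⟩
      rw [eq_bot_of_comap_eq_bot hD hR hQ]
      exact one_notMem_extension_of_mem_contractedPrimes
        (bot_mem_contractedPrimes (sInf_le hT))
    · obtain ⟨T, hT, hTΘ', hPT⟩ := hsep.exists_one_notMem hΘ hR ⟨Q, rfl⟩ hQ
      exact ⟨T, hTΘ', one_notMem_extension_of_comap hD hR (hΘ.flat T hT) hPT⟩

/-! ### Jaffard overrings in a flat partition -/

theorem inv_mem_of_isUnit {A : Subring K} {a : K} (ha : a ∈ A) (hu : IsUnit (⟨a, ha⟩ : A)) :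
    a⁻¹ ∈ A := by
  obtain ⟨b, hb⟩ := hu.exists_right_inv
  have hb' : a * (b : K) = 1 := congrArg A.subtype hb
  rw [inv_eq_of_mul_eq_one_right hb']
  exact b.2

/-- By local finiteness only finitely many members omit `a⁻¹`. These form a compact family, and the
other members impose no condition. -/
theorem IsJaffardFamily.isCarried_inv {D : Subring K} {Θ : Set (Subring K)}
    (hΘ : IsJaffardFamily D Θ) {T : Subring K} (hT : T ∈ Θ) {a : K} (ha : a ∈ D)
    (ha0 : a ≠ 0) : IsCarried D T (sInf (Θ \ {T}) : Subring K) a⁻¹ := by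
  let N : Set (Subring K) := {A ∈ Θ | ∃ h : a ∈ A, ¬ IsUnit (⟨a, h⟩ : A)} \ {T}
  have hN : N.Finite := (hΘ.locallyFinite a ha0).subset Set.sdiff_subset
  have hNΘ : ∀ A ∈ N, A ∈ Θ := fun A hA => hA.1.1
  have hcarried : IsCarried D T (sInf N : Subring K) a⁻¹ :=
    isCarried_sInf_of_isCompact (hΘ.overring T hT) (fun A hA => hΘ.overring A (hNΘ A hA))
      hN.isCompact fun A hA => isCarried_inv_of_inter_eq_bot (hΘ.overring A (hNΘ A hA))
        (hΘ.overring T hT) (hΘ.flat T hT) (hΘ.independent A (hNΘ A hA) T hT hA.2 _ _) ha ha0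
  obtain ⟨J, hJ, hJa⟩ := hcarried
  refine ⟨J, hJ, fun d hd => Subring.mem_sInf.mpr fun A hA => ?_⟩
  by_cases hu : IsUnit (⟨a, hΘ.overring A hA.1 ha⟩ : A)
  · exact mul_mem (hΘ.overring A hA.1 d.2) (inv_mem_of_isUnit _ hu)
  · exact Subring.mem_sInf.mp (hJa d hd) A ⟨⟨hA.1, _, hu⟩, hA.2⟩

/-- The complement of a Jaffard overring in a Jaffard family is contained in its complement in
any flat partition. -/
theorem IsJaffardFamily.sInf_diff_le {D : Subring K} (hD : HasDenominators D)
    {Θ Θ' : Set (Subring K)} (hΘ' : IsJaffardFamily D Θ') (hΘ : IsFlatPartition D Θ)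
    {T : Subring K} (hT : T ∈ Θ) : sInf (Θ' \ {T}) ≤ sInf (Θ \ {T}) := by
  refine fun s hs => Subring.mem_sInf.mpr fun A hA => ?_
  suffices IsCarried D A A s from this.mem le_rfl
  refine ⟨colonIdeal le_rfl s, ?_, fun d hd => hΘ.overring A hA.1 hd⟩
  by_contra h1
  obtain ⟨P, hP, hle⟩ := exists_prime_over_of_one_notMem (hΘ.overring A hA.1) h1
  obtain ⟨B, hB, hPB⟩ := hΘ'.complete.exists_one_notMem P.2.ne_top
  -- `P` is nonzero and in `σ(A)`, so independence of `Θ` keeps it out of `σ(T)`.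
  have hBT : B ≠ T := by
    rintro rfl
    have hbot : P ∈ ({⊥} : Set _) := hΘ.independent A hA.1 B hT hA.2 (hΘ.overring A hA.1)
      (hΘ.overring B hT) ▸ ⟨hP, mem_contractedPrimes_of_one_notMem (hΘ.flat B hT) _ hPB⟩
    exact ne_bot_of_colonIdeal_le hD hle hbot
  exact hPB (extension_mono hle B ((hΘ'.flat B hB).one_mem_extension_colonIdeal hD
    (Subring.mem_sInf.mp hs B ⟨hB, hBT⟩)))

theorem IsFlatPartition.isSeparatedSubfamily_diff_singleton {D : Subring K}
    (hD : HasDenominators D) {Θ : Set (Subring K)} (hΘ : IsFlatPartition D Θ) {T : Subring K}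
    (hT : T ∈ jaffardPart D Θ) : IsSeparatedSubfamily D Θ (Θ \ {T}) := by
  intro A hA hAT a ha ha0
  obtain rfl : A = T := by
    by_contra hne
    exact hAT ⟨hA, hne⟩
  -- The Jaffard family witnessing `T` may be unrelated to `Θ`, so its complement of `T` is compared
  -- with that in `Θ`.
  obtain ⟨Θ', hΘ', hTΘ'⟩ := hT.2
  exact (hΘ'.isCarried_inv hTΘ' ha ha0).mono (hΘ'.sInf_diff_le hD hΘ hA)

/-- A Jaffard overring is isolated among the members of a flat partition in which a given
element is not a unit. -/
theorem IsFlatPartition.exists_basicOpen {D : Subring K} (hD : HasDenominators D)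
    {Θ : Set (Subring K)} (hΘ : IsFlatPartition D Θ) {T : Subring K}
    (hT : T ∈ jaffardPart D Θ) {a : K} (ha : a ∈ D) (ha0 : a ≠ 0) :
    ∃ F : Finset K, T ∈ basicOpen F ∧ ∀ A ∈ Θ, A ≠ T → A ∈ basicOpen F → a⁻¹ ∈ A := by
  classical
  have hsep := hΘ.isSeparatedSubfamily_diff_singleton hD hT
  have hS := le_sInf_of_subset hΘ.overring (Set.sdiff_subset (s := Θ) (t := {T}))
  have hDT := hΘ.overring T hT.1
  have hinter := inter_eq_bot_of_forall_isCarried_inv hS hDT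
    (hsep T hT.1 fun h => h.2 rfl)
  -- The roles are now exchanged: as `S = ⋂ (Θ \ {T})` is flat, `a⁻¹` is carried into `T` by an
  -- ideal that becomes trivial in `S`, hence in every other member.
  obtain ⟨J, hJ, hJa⟩ := isCarried_inv_of_inter_eq_bot hDT hS
    (hsep.isFlatOverring_sInf hD hΘ Set.sdiff_subset) hinter ha ha0
  obtain ⟨F, hF, hF1⟩ := exists_finset_of_one_mem_extension hJ
  refine ⟨F.image (· * a⁻¹), fun y hy => ?_, fun A hA hAT hAF => ?_⟩
  · obtain ⟨f, hf, rfl⟩ := Finset.mem_image.mp hy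
    obtain ⟨d, hd, rfl⟩ := hF f hf
    exact hJa d hd
  · exact mem_of_one_mem_span (sInf_le (show A ∈ Θ \ {T} from ⟨hA, hAT⟩)) hF1
      fun f hf => hAF _ (Finset.mem_image_of_mem _ hf)

/-- The isolating neighbourhoods of the removed rings are added to the open set; among members
omitting `a⁻¹` they meet `Θ'` only in those rings. -/
theorem IsClosedAwayFromInverses.diff_jaffardPart {D R : Subring K} {Θ Θ' : Set (Subring K)}
    (h : IsClosedAwayFromInverses D Θ Θ') (hDR : D ≤ R) (hR : HasDenominators R)
    (hΘ' : Θ'.Nonempty → IsFlatPartition R Θ') :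
    IsClosedAwayFromInverses D Θ (Θ' \ jaffardPart R Θ') := by
  intro a ha ha0
  obtain ⟨U, hU, hUA⟩ := h a ha ha0
  choose F hTF hF using fun T : jaffardPart R Θ' =>
    (hΘ' ⟨T, T.2.1⟩).exists_basicOpen hR T.2 (hDR ha) ha0
  refine ⟨U ∪ ⋃ T, basicOpen (F T), hU.union (isOpen_iUnion fun T => isOpen_basicOpen _),
    fun A hA haA => ⟨?_, fun hAU => ?_⟩⟩
  · rintro ⟨hAΘ', hAJ⟩ (hAU | hAF)
    · exact (hUA A hA haA).mp hAΘ' hAU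
    · obtain ⟨T, hAT⟩ := Set.mem_iUnion.mp hAF
      exact haA (hF T A hAΘ' (fun hEq => hAJ (hEq ▸ T.2)) hAT)
  · refine ⟨(hUA A hA haA).mpr fun hAU' => hAU (Or.inl hAU'), fun hAJ => hAU (Or.inr ?_)⟩
    exact Set.mem_iUnion.mpr ⟨⟨A, hAJ⟩, hTF ⟨A, hAJ⟩⟩

/-- Replacing the remaining members by their intersection `R` keeps completeness, because `I R ⊆ I
T` for each of them, and independence, because `R` is separated from the removed ones. -/
theorem IsFlatPartition.isWeakJaffardFamily {D : Subring K} (hD : HasDenominators D)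
    {Θ : Set (Subring K)} (hΘ : IsFlatPartition D Θ) (hne : (Θ \ jaffardPart D Θ).Nonempty)
    (hc : IsZariskiCompact (Θ \ jaffardPart D Θ)) :
    IsWeakJaffardFamily D (jaffardPart D Θ ∪ {sInf (Θ \ jaffardPart D Θ)})
      (sInf (Θ \ jaffardPart D Θ)) := by
  set R := sInf (Θ \ jaffardPart D Θ) with hRdef
  have hR : D ≤ R := le_sInf_of_subset hΘ.overring Set.sdiff_subset
  have hsep := hΘ.isSeparatedSubfamily Set.sdiff_subset hc
  have hdisj : ∀ A ∈ jaffardPart D Θ, ∀ (hA : D ≤ A),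
      contractedPrimes hA ∩ contractedPrimes hR = {⊥} := fun A hA hDA =>
    inter_eq_bot_of_forall_isCarried_inv hR hDA (hsep A hA.1 fun h => h.2 hA)
  refine ⟨?_, Or.inr rfl, Or.inl ?_, fun I => ?_, ?_, ?_, hsep.isFlatOverring_sInf hD hΘ
    Set.sdiff_subset⟩
  · rintro T (hT | rfl)
    exacts [hΘ.overring T hT.1, hR]
  · rintro (h | h)
    · exact hΘ.top_notMem h.1
    · obtain ⟨A, hA⟩ := hne
      have hRA : R ≤ A := sInf_le hA
      rw [← Set.mem_singleton_iff.mp h, top_le_iff] at hRA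
      exact hΘ.top_notMem (hRA ▸ hA.1)
  · refine subset_antisymm (image_subset_iInter_extension _ I) fun x hx => ?_
    rw [hΘ.complete I]
    have hx' := Set.mem_iInter₂.mp hx
    refine Set.mem_iInter₂.mpr fun T hT => ?_
    by_cases hTJ : T ∈ jaffardPart D Θ
    · exact hx' T (Or.inl hTJ)
    · exact extension_subset_of_le I (show R ≤ T from sInf_le ⟨hT, hTJ⟩)
        (hx' R (Or.inr rfl))
  · rintro A (hA | rfl) B (hB | rfl) hAB hDA hDB
    · exact hΘ.independent A hA.1 B hB.1 hAB hDA hDB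
    · exact hdisj A hA hDA
    · rw [Set.inter_comm]
      exact hdisj B hB hDB
    · exact absurd rfl hAB
  · rintro T ⟨hT | hT, hTR⟩
    · exact hT.2
    · exact absurd hT hTR

/-! ### The derived sequence -/

theorem derivedFamily_subset (D : Subring K) (Θ : Set (Subring K)) (α : Ordinal.{v}) :
    derivedFamily D Θ α ⊆ Θ := by
  induction α using Ordinal.limitRecOn with
  | zero => rw [derivedFamily_zero]
  | add_one γ ih =>
    rw [derivedFamily_add_one]
    exact Set.sdiff_subset.trans ih
  | limit α hα ih =>
    rw [derivedFamily_limit D Θ hα]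
    exact fun T hT => ih ⊥ hα.bot_lt (Set.mem_iInter₂.mp hT ⊥ hα.bot_lt)

theorem le_derivedRing {D : Subring K} {Θ : Set (Subring K)} (hΘ : ∀ T ∈ Θ, D ≤ T)
    (α : Ordinal.{v}) : D ≤ derivedRing D Θ α := by
  by_cases hα : α = 0
  · rw [hα, derivedRing_zero]
  · rw [derivedRing_of_ne_zero D Θ hα]
    exact le_sInf_of_subset hΘ (derivedFamily_subset D Θ α)

theorem IsPreJaffardFamily.derived_of_isClosedAwayFromInverses {D : Subring K}
    (hD : HasDenominators D) {Θ : Set (Subring K)} (hΘ : IsPreJaffardFamily D Θ)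
    (htop : ⊤ ∉ Θ) {α : Ordinal.{v}}
    (hα : IsClosedAwayFromInverses D Θ (derivedFamily D Θ α))
    (hne : (derivedFamily D Θ α).Nonempty) :
    IsPreJaffardFamily (derivedRing D Θ α) (derivedFamily D Θ α) := by
  by_cases h0 : α = 0
  · rwa [h0, derivedRing_zero, derivedFamily_zero]
  · rw [derivedRing_of_ne_zero D Θ h0]
    exact (hΘ.isFlatPartition htop).isPreJaffardFamily_sInf hD (derivedFamily_subset D Θ α) hne
      (hα.isZariskiCompact hD hΘ.overring hΘ.compact (derivedFamily_subset D Θ α))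

theorem IsPreJaffardFamily.isFlatPartition_derived {D : Subring K}
    (hD : HasDenominators D) {Θ : Set (Subring K)} (hΘ : IsPreJaffardFamily D Θ)
    (htop : ⊤ ∉ Θ) {α : Ordinal.{v}}
    (hα : IsClosedAwayFromInverses D Θ (derivedFamily D Θ α))
    (hne : (derivedFamily D Θ α).Nonempty) :
    IsFlatPartition (derivedRing D Θ α) (derivedFamily D Θ α) :=
  (hΘ.derived_of_isClosedAwayFromInverses hD htop hα hne).isFlatPartition
    fun h => htop (derivedFamily_subset D Θ α h)

theorem IsPreJaffardFamily.isClosedAwayFromInverses_derived {D : Subring K}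
    (hD : HasDenominators D) {Θ : Set (Subring K)} (hΘ : IsPreJaffardFamily D Θ)
    (htop : ⊤ ∉ Θ) (α : Ordinal.{v}) :
    IsClosedAwayFromInverses D Θ (derivedFamily D Θ α) := by
  induction α using Ordinal.limitRecOn with
  | zero =>
    rw [derivedFamily_zero]
    exact isClosedAwayFromInverses_refl D Θ
  | add_one γ ih =>
    rw [derivedFamily_add_one]
    have hle := le_derivedRing hΘ.overring γ
    exact ih.diff_jaffardPart hle (hD.mono hle)
      fun hne => hΘ.isFlatPartition_derived hD htop ih hne
  | limit α hα ih =>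
    rw [derivedFamily_limit D Θ hα]
    exact .iInter fun β => .iInter fun hβ => ih β hβ

theorem derivedFamily_eq_empty_of_top {D : Subring K} {Θ : Set (Subring K)}
    (hΘ : IsPreJaffardFamily D Θ) (htop : Θ = {⊤}) {α : Ordinal.{v}} (hα : α ≠ 0) :
    derivedFamily D Θ α = ∅ := by
  have hJ : IsJaffardFamily D Θ :=
    ⟨hΘ.overring, hΘ.top_notMem_or, hΘ.flat, hΘ.complete, hΘ.independent, fun x _ =>
      (htop ▸ Set.finite_singleton ⊤ : Θ.Finite).subset (Set.sep_subset _ _)⟩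
  have h1 : derivedFamily D Θ (0 + 1 : Ordinal.{v}) = ∅ := by
    rw [derivedFamily_add_one, derivedFamily_zero, derivedRing_zero, Set.sdiff_eq_empty]
    exact fun T hT => ⟨hT, Θ, hJ, hT⟩
  induction α using Ordinal.limitRecOn with
  | zero => exact absurd rfl hα
  | add_one γ ih =>
    by_cases hγ : γ = 0
    · rw [hγ, h1]
    · rw [derivedFamily_add_one, ih hγ, Set.empty_sdiff]
  | limit α hlim ih =>
    rw [derivedFamily_limit D Θ hlim]
    have h01 : (0 + 1 : Ordinal.{v}) < α := hlim.succ_lt hlim.bot_lt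
    exact Set.subset_eq_empty (Set.biInter_subset_of_mem h01) h1

end JaffardFamilies

theorem mainTheorem8 {K : Type u} [Field K] (D : Subring K) [IsFractionRing D K]
    (Θ : Set (Subring K)) (hΘ : IsPreJaffardFamily D Θ) :
    (∀ α : Ordinal.{v}, (derivedFamily D Θ α).Nonempty →
      IsPreJaffardFamily (derivedRing D Θ α) (derivedFamily D Θ α)) ∧
    (∀ α γ : Ordinal.{v}, α = γ + 1 → (derivedFamily D Θ α).Nonempty →
      IsWeakJaffardFamily (derivedRing D Θ γ)
        (jaffardPart (derivedRing D Θ γ) (derivedFamily D Θ γ) ∪ {derivedRing D Θ α})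
        (derivedRing D Θ α)) := by
  have hD := hasDenominators_of_isFractionRing D
  rcases hΘ.top_notMem_or with htop | htop
  · have hclosed := hΘ.isClosedAwayFromInverses_derived hD htop
    refine ⟨fun α => hΘ.derived_of_isClosedAwayFromInverses hD htop (hclosed α), ?_⟩
    rintro _ γ rfl hne
    have hc := (hclosed (γ + 1)).isZariskiCompact hD hΘ.overring hΘ.compact
      (derivedFamily_subset D Θ (γ + 1))
    rw [derivedRing_of_ne_zero D Θ (show γ + 1 ≠ 0 from Order.succ_ne_bot γ)]
    rw [derivedFamily_add_one] at hne hc ⊢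
    exact (hΘ.isFlatPartition_derived hD htop (hclosed γ)
      (hne.mono Set.sdiff_subset)).isWeakJaffardFamily
        (hD.mono (le_derivedRing hΘ.overring γ)) hne hc
  -- The family `{K}` is itself Jaffard, so the sequence is exhausted after one step and only `α =
  -- 0` remains.
  · have hempty := fun (α : Ordinal.{v}) => derivedFamily_eq_empty_of_top hΘ htop (α := α)
    refine ⟨fun α hne => ?_, fun α γ hα hne => ?_⟩
    · obtain rfl : α = 0 := by
        by_contra hα
        exact hne.ne_empty (hempty α hα)
      rwa [derivedRing_zero, derivedFamily_zero]
    · exact absurd (hempty α (hα ▸ Order.succ_ne_bot γ)) hne.ne_empty
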